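/- Let $K$ be a subfield of $\mathbb{C}$ (for instance $K=\mathbb{R}$ or $K=\mathbb{C}$), and let $\mathcal X=(x_1,\dots,x_7)$ and $\mathcal Y=(y_1,\dots,y_7)$ be two $7$-tuples of points of $\mathbb{P}^2(K)$. A flatland camera over $K$ is a $2\times 3$ matrix over $K$ of rank $2$, and its center is the point of $\mathbb{P}^2(K)$ spanned by its kernel. Call $(a,b)\in\mathbb{P}^2(K)\times\mathbb{P}^2(K)$ a center pair if there are flatland cameras $A,B$ over $K$ with centers $a,b$ such that, for every $i$, $Ax_i$ and $By_i$ are nonzero and equal up to a nonzero scalar. The camera centers variety $\mathcal E=\mathcal E_{\mathcal X,\mathcal Y}\subset\mathbb{P}^2(\mathbb{C})\times\mathbb{P}^2(\mathbb{C})$ is the set of all $(a,b)$ for which there is a nonzero complex $3\times 3$ matrix $F$ with $Fa=0$, $F^{T}b=0$ and $y_i^{T}Fx_i=0$ for $i=1,\dots,7$. Let $L$ be the $K$-vector space of all $3\times 3$ matrices $F$ over $K$ with $y_i^TFx_i=0$ for $i=1,\dots,7$. There is a nonempty Zariski open set of pairs $(\mathcal X,\mathcal Y)$ (the configurations having homogeneous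 coordinates at which a certain nonzero polynomial over $K$ in these coordinates does not vanish) such that, for every $(\mathcal X,\mathcal Y)$ in it, the following hold. 1. $\dim_K L=2$. For any basis $F_1,F_2$ of $L$, the three coordinates of $F_1a\times F_2a$ (as quadratic forms in $a$) define three distinct plane conics $\omega_{a,1},\omega_{a,2},\omega_{a,3}$, and the three coordinates of $F_1^{T}b\times F_2^{T}b$ define three distinct plane conics $\omega_{b,1},\omega_{b,2},\omega_{b,3}$. If $(a,b)$ is a center pair, or a point of $\mathcal E$, then $a\in\bigcap_i\omega_{a,i}$ and $b\in\bigcap_i\omega_{b,i}$. 2. Each triple of conics meets in exactly three complex points: $$\#\bigcap_{i=1}^3\omega_{a,i}=\#\bigcap_{i=1}^3\omega_{b,i}=3 .$$ 3. Each center determines the other: for every complex point $a\in\bigcap_i\omega_{a,i}$ there is exactly one $b$ with $(a,b)\in\mathcal E$, and for every complex point $b\in\bigcap_i\omega_{b,i}$ there is exactly one $a$ with $(a,b)\in\mathcal E$; if $(a,b)$ and $(a,b')$ are center pairs then $b=b'$, and if $(a,b)$ and $(a',b)$ are center pairs then $a=a'$. 4. Every center pair lies in $\mathcal E$; the variety $\mathcal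 E$ consists of exactly three points, its multidegree $d_{(0,0)}(\mathcal E)$ (the number of points in which it meets $0$ generic lines of the first plane and $0$ generic lines of the second) is $3$, and there are at most three center pairs $(a,b)$. -/

import Mathlib

open scoped Matrix LinearAlgebra.Projectivization

namespace FlatlandCameras

/-- The projective plane over `K`. -/
abbrev Plane (K : Type*) [Field K] : Type _ := ℙ K (Fin 3 → K)

/-- The point of the complex projective plane with the same homogeneous coordinates. -/
noncomputable def toComplex {K : Type*} [Field K] [Algebra K ℂ] (p : Plane K) : Plane ℂ :=
  Projectivization.mk ℂ (fun j => algebraMap K ℂ (p.rep j)) (by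
    intro h
    apply p.rep_nonzero
    funext j
    have hj := congrFun h j
    simpa using hj)

/-- A property of pairs `(X, Y)` of labeled `n`-point configurations in the plane holds for generic
`(X, Y)`: it holds off the zero locus of some nonzero polynomial in the homogeneous coordinates.
The set of configurations for which some choice of coordinates avoids the zero locus of `Δ`
is the union of the nonvanishing loci of the multihomogeneous components of `Δ`, a nonempty
Zariski open subset of the product of projective planes. -/
def HoldsGenerically {K : Type*} [Field K] (n : ℕ)
    (P : (Fin n → Plane K) → (Fin n → Plane K) → Prop) : Prop :=
  ∃ Δ : MvPolynomial ((Fin n × Fin 3) ⊕ (Fin n × Fin 3)) K, Δ ≠ 0 ∧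
    ∀ (u v : Fin n → Fin 3 → K) (hu : ∀ i, u i ≠ 0) (hv : ∀ i, v i ≠ 0),
      MvPolynomial.eval (Sum.elim (fun s => u s.1 s.2) (fun s => v s.1 s.2)) Δ ≠ 0 →
        P (fun i => Projectivization.mk K (u i) (hu i))
          (fun i => Projectivization.mk K (v i) (hv i))

/-- `a` and `b` are the centers of two flatland cameras (rank-2 projections from the plane to the
line) `A`, `B` with `A xᵢ ∼ B yᵢ` for all `i`, i.e. both images are defined and they are equal as
points of the projective line. -/
def IsCenterPair {K : Type*} [Field K] {n : ℕ} (X Y : Fin n → Plane K) (a b : Plane K) : Prop :=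
  ∃ A B : Matrix (Fin 2) (Fin 3) K, A.rank = 2 ∧ B.rank = 2 ∧
    A *ᵥ a.rep = 0 ∧ B *ᵥ b.rep = 0 ∧
    ∀ i, A *ᵥ (X i).rep ≠ 0 ∧ B *ᵥ (Y i).rep ≠ 0 ∧
      ∃ c : K, c ≠ 0 ∧ A *ᵥ (X i).rep = c • (B *ᵥ (Y i).rep)

/-- The linear space of `3 × 3` matrices `F` with `yᵢᵀ F xᵢ = 0` for all `i`. -/
noncomputable def matrixSpace {K : Type*} [Field K] {n : ℕ} (X Y : Fin n → Plane K) :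
    Submodule K (Matrix (Fin 3) (Fin 3) K) where
  carrier := {F | ∀ i, (Y i).rep ⬝ᵥ (F *ᵥ (X i).rep) = 0}
  add_mem' := by
    intro F G hF hG i
    rw [Matrix.add_mulVec, dotProduct_add, hF i, hG i, add_zero]
  zero_mem' := by
    intro i
    rw [Matrix.zero_mulVec, dotProduct_zero]
  smul_mem' := by
    intro c F hF i
    rw [Matrix.smul_mulVec, dotProduct_smul, hF i, smul_zero]

/-- The camera centers variety: all `(a, b)` for which there is `F ≠ 0` with `F a = 0`,
`Fᵀ b = 0` and `yᵢᵀ F xᵢ = 0` for all `i`. -/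
def centersVariety {K : Type*} [Field K] {n : ℕ} (X Y : Fin n → Plane K) :
    Set (Plane K × Plane K) :=
  {p | ∃ F ∈ matrixSpace X Y, F ≠ 0 ∧ F *ᵥ p.1.rep = 0 ∧ Fᵀ *ᵥ p.2.rep = 0}

/-- The camera centers variety of data over `K ⊆ ℂ`, as a set of complex points. -/
def complexCentersVariety {K : Type*} [Field K] [Algebra K ℂ] {n : ℕ} (X Y : Fin n → Plane K) :
    Set (Plane ℂ × Plane ℂ) :=
  centersVariety (fun i => toComplex (X i)) (fun i => toComplex (Y i))

/-- The vector of linear forms `F z`, in the indeterminate point `z = (z₀, z₁, z₂)`. -/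
noncomputable def linearForms {K : Type*} [Field K] (F : Matrix (Fin 3) (Fin 3) K) :
    Fin 3 → MvPolynomial (Fin 3) K :=
  (F.map MvPolynomial.C) *ᵥ MvPolynomial.X

/-- The three coordinates of the cross product `F₁ z × F₂ z`. -/
noncomputable def crossConics {K : Type*} [Field K] (F₁ F₂ : Matrix (Fin 3) (Fin 3) K) :
    Fin 3 → MvPolynomial (Fin 3) K :=
  crossProduct (linearForms F₁) (linearForms F₂)

/-- The three polynomials are equations of three distinct plane conics: nonzero quadratic
forms, no two of which are proportional. -/
def IsConicTriple {K : Type*} [Field K] (ω : Fin 3 → MvPolynomial (Fin 3) K) : Prop :=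
  (∀ i, (ω i).IsHomogeneous 2 ∧ ω i ≠ 0) ∧
    ∀ i j, i ≠ j → LinearIndependent K ![ω i, ω j]

/-- The common zeros of the polynomials `ω i` in the complex projective plane. -/
def complexIntersection {K : Type*} [Field K] [Algebra K ℂ]
    (ω : Fin 3 → MvPolynomial (Fin 3) K) : Set (Plane ℂ) :=
  ⋂ i, {p | MvPolynomial.aeval p.rep (ω i) = 0}

/-- The multidegree `d_{(i,j)}` of `V ⊆ ℙ² × ℙ²` equals `d` (for `V` of dimension `i + j`): `V` meets
`i` generic lines of the first plane and `j` generic lines of the second in exactly `d` points. -/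
def HasMultidegree (V : Set (Plane ℂ × Plane ℂ)) (i j d : ℕ) : Prop :=
  ∃ Δ : MvPolynomial ((Fin i × Fin 3) ⊕ (Fin j × Fin 3)) ℂ, Δ ≠ 0 ∧
    ∀ (l : Fin i → Fin 3 → ℂ) (m : Fin j → Fin 3 → ℂ),
      MvPolynomial.eval (Sum.elim (fun s => l s.1 s.2) (fun s => m s.1 s.2)) Δ ≠ 0 →
        {p ∈ V | (∀ k, l k ⬝ᵥ p.1.rep = 0) ∧ ∀ k, m k ⬝ᵥ p.2.rep = 0}.encard = d

end FlatlandCameras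

open FlatlandCameras

/-! Two cameras `A`, `B` that agree on the data give `F = Bᵀ J A` with `J` alternating; it lies in
`L`, kills `a`, and its transpose kills `b` (`IsCenterPair.mem_centersVariety`). So everything
reduces to the singular members of `L`.

For generic data `L` is a pencil which over `ℂ` has the form `P * diagonal * Q`, with pairwise
distinct ratios of diagonal entries. It has exactly three singular members up to scale, all of rank
2, with kernels `Q⁻¹ eᵢ` and cokernels `P⁻ᵀ eᵢ`. The cross product `F₁ a × F₂ a` vanishes exactly
when some nonzero member kills `a`, so the conics meet in the three kernels, and the common index
`i` pairs each `a` with one `b` (`IsSplitPencil.exists_points`).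

Genericity is witnessed by `designDiscr`. The adjugate of a completed 9 × 9 system gives a basis of
`L` that is polynomial in the coordinates; `isSplitPencil_of_discr_ne_zero` turns nonvanishing into
the diagonal form, and one explicit configuration shows that the polynomial is nonzero. -/

namespace FlatlandCameras

/-! ### Pencils of matrices equivalent to diagonal ones -/

section Pencil

variable {k : Type*} [Field k]

/-- The pencil spanned by `F` and `G` is equivalent to a pencil of diagonal matrices with three
distinct singular members. -/
def IsSplitPencil (F G : Matrix (Fin 3) (Fin 3) k) : Prop :=
  ∃ (P Q : Matrix (Fin 3) (Fin 3) k) (α β : Fin 3 → k), P.det ≠ 0 ∧ Q.det ≠ 0 ∧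
    F = P * Matrix.diagonal α * Q ∧ G = P * Matrix.diagonal β * Q ∧
    ∀ i j, i ≠ j → α i * β j - α j * β i ≠ 0

theorem IsSplitPencil.transpose {F G : Matrix (Fin 3) (Fin 3) k} (h : IsSplitPencil F G) :
    IsSplitPencil Fᵀ Gᵀ := by
  obtain ⟨P, Q, α, β, hP, hQ, rfl, rfl, hαβ⟩ := h
  exact ⟨Qᵀ, Pᵀ, α, β, by simpa using hQ, by simpa using hP,
    by simp [Matrix.transpose_mul, Matrix.mul_assoc],
    by simp [Matrix.transpose_mul, Matrix.mul_assoc], hαβ⟩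

theorem smul_add_smul_mul_diagonal_mul (P Q : Matrix (Fin 3) (Fin 3) k) (α β : Fin 3 → k)
    (x y : k) : x • (P * Matrix.diagonal α * Q) + y • (P * Matrix.diagonal β * Q) =
      P * Matrix.diagonal (x • α + y • β) * Q := by
  have : Matrix.diagonal (x • α + y • β) = x • Matrix.diagonal α + y • Matrix.diagonal β := by
    rw [← Matrix.diagonal_smul, ← Matrix.diagonal_smul, Matrix.diagonal_add]
    rfl
  rw [this]
  simp [Matrix.mul_add, Matrix.add_mul]

/-- The same `P` and `Q` serve; each minor of `(α, β)` is multiplied by `p * s - q * r`. -/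
theorem IsSplitPencil.change_basis {F G : Matrix (Fin 3) (Fin 3) k} (h : IsSplitPencil F G)
    {p q r s : k} (hd : p * s - q * r ≠ 0) :
    IsSplitPencil (p • F + q • G) (r • F + s • G) := by
  obtain ⟨P, Q, α, β, hP, hQ, rfl, rfl, hαβ⟩ := h
  refine ⟨P, Q, p • α + q • β, r • α + s • β, hP, hQ,
    smul_add_smul_mul_diagonal_mul .., smul_add_smul_mul_diagonal_mul .., fun i j hij => ?_⟩
  have := mul_ne_zero hd (hαβ i j hij)
  convert this using 1
  simp only [Pi.add_apply, Pi.smul_apply, smul_eq_mul]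
  ring

theorem mulVec_eq_zero_iff_of_det_ne_zero {P : Matrix (Fin 3) (Fin 3) k} (hP : P.det ≠ 0)
    (x : Fin 3 → k) : P *ᵥ x = 0 ↔ x = 0 :=
  ⟨Matrix.eq_zero_of_mulVec_eq_zero hP, fun h => by simp [h]⟩

theorem mul_diagonal_mul_mulVec_eq_zero_iff {P Q : Matrix (Fin 3) (Fin 3) k} (hP : P.det ≠ 0)
    (d x : Fin 3 → k) :
    (P * Matrix.diagonal d * Q) *ᵥ x = 0 ↔ ∀ i, d i * (Q *ᵥ x) i = 0 := by
  rw [← Matrix.mulVec_mulVec, ← Matrix.mulVec_mulVec, mulVec_eq_zero_iff_of_det_ne_zero hP,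
    funext_iff]
  simp [Matrix.mulVec_diagonal]

/-- The points whose images under the invertible matrix `Q` are the coordinate points. -/
theorem exists_points_of_det_ne_zero {Q : Matrix (Fin 3) (Fin 3) k} (hQ : Q.det ≠ 0) :
    ∃ p : Fin 3 → Plane k, Function.Injective p ∧
      ∀ a i, a = p i ↔ ∀ j, j ≠ i → (Q *ᵥ a.rep) j = 0 := by
  have hu : IsUnit Q.det := isUnit_iff_ne_zero.2 hQ
  have hne : ∀ i, Q⁻¹ *ᵥ Pi.single i 1 ≠ 0 := by
    intro i h
    have := congrArg (fun x => (Q *ᵥ x) i) h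
    simp [Matrix.mulVec_mulVec, Matrix.mul_nonsing_inv _ hu, -Matrix.mulVec_single] at this
  have key : ∀ a i, a = Projectivization.mk k _ (hne i) ↔ ∀ j, j ≠ i → (Q *ᵥ a.rep) j = 0 := by
    intro a i
    conv_lhs => rw [← a.mk_rep]
    rw [Projectivization.mk_eq_mk_iff']
    constructor
    · rintro ⟨c, hc⟩ j hj
      rw [← hc, Matrix.mulVec_smul, Matrix.mulVec_mulVec, Matrix.mul_nonsing_inv _ hu]
      simp [hj, -Matrix.mulVec_single]
    · intro h
      refine ⟨(Q *ᵥ a.rep) i, ?_⟩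
      rw [← Matrix.mulVec_smul]
      have : (Q *ᵥ a.rep) i • (Pi.single i 1 : Fin 3 → k) = Q *ᵥ a.rep := by
        ext j
        by_cases hj : j = i
        · subst hj; simp
        · simp [hj, h j hj]
      rw [this, Matrix.mulVec_mulVec, Matrix.nonsing_inv_mul _ hu, Matrix.one_mulVec]
  refine ⟨_, fun i i' hii => ?_, key⟩
  by_contra hne'
  have h1 := (key _ i).1 rfl
  have h2 := (key _ i').1 hii
  apply (Projectivization.mk k _ (hne i)).rep_nonzero
  rw [← mulVec_eq_zero_iff_of_det_ne_zero hQ]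
  ext j
  by_cases hj : j = i
  · exact h2 j (hj ▸ hne')
  · exact h1 j hj

/-- Applied to `F a` and `G a`, this turns membership in the conics into the existence of a member
of the pencil that kills `a`. -/
theorem crossProduct_eq_zero_iff_exists {v w : Fin 3 → k} :
    crossProduct v w = 0 ↔ ∃ s t : k, (s ≠ 0 ∨ t ≠ 0) ∧ s • v + t • w = 0 := by
  rw [← not_iff_not, ← ne_eq, crossProduct_ne_zero_iff_linearIndependent, LinearIndependent.pair_iff]
  push Not
  refine forall₂_congr fun s t => ?_
  constructor
  · intro h h1 h2
    obtain ⟨rfl, rfl⟩ := h h2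
    simp at h1
  · intro h h1
    by_contra h2
    exact h (by tauto) h1

/-- The singular members of a split pencil, their kernels and their cokernels. -/
theorem IsSplitPencil.exists_points {F G : Matrix (Fin 3) (Fin 3) k} (h : IsSplitPencil F G) :
    ∃ p q : Fin 3 → Plane k, Function.Injective p ∧ Function.Injective q ∧
      (∀ a, crossProduct (F *ᵥ a.rep) (G *ᵥ a.rep) = 0 ↔ ∃ i, a = p i) ∧
      (∀ b, crossProduct (Fᵀ *ᵥ b.rep) (Gᵀ *ᵥ b.rep) = 0 ↔ ∃ i, b = q i) ∧
      ∀ a b, (∃ H ∈ Submodule.span k {F, G}, H ≠ 0 ∧ H *ᵥ a.rep = 0 ∧ Hᵀ *ᵥ b.rep = 0) ↔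
        ∃ i, a = p i ∧ b = q i := by
  obtain ⟨P, Q, α, β, hP, hQ, rfl, rfl, hαβ⟩ := h
  -- The pairs `(α i, β i)` are pairwise non-proportional, so a nonzero combination has at most one
  -- zero on its diagonal.
  have unique : ∀ s t : k, (s ≠ 0 ∨ t ≠ 0) → ∀ i j, s * α i + t * β i = 0 →
      s * α j + t * β j = 0 → i = j := by
    intro s t hst i j hi hj
    by_contra hij
    have h1 := hαβ i j hij
    rcases hst with hs | ht
    · apply mul_ne_zero hs h1
      linear_combination β j * hi - β i * hj
    · apply mul_ne_zero ht h1
      linear_combination α i * hj - α j * hi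
  -- `R` is `Q` for kernels and `Pᵀ` for cokernels.
  have single : ∀ (R : Matrix (Fin 3) (Fin 3) k), R.det ≠ 0 → ∀ (a : Plane k) (s t : k),
      (s ≠ 0 ∨ t ≠ 0) → (∀ i, (s * α i + t * β i) * (R *ᵥ a.rep) i = 0) →
      ∃ i, s * α i + t * β i = 0 ∧ ∀ j, j ≠ i → (R *ᵥ a.rep) j = 0 := by
    intro R hR a s t hst h
    have : R *ᵥ a.rep ≠ 0 := by
      rw [ne_eq, mulVec_eq_zero_iff_of_det_ne_zero hR]
      exact a.rep_nonzero
    obtain ⟨i, hi⟩ := Function.ne_iff.1 this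
    have hi' : s * α i + t * β i = 0 := (mul_eq_zero.1 (h i)).resolve_right hi
    refine ⟨i, hi', fun j hj => (mul_eq_zero.1 (h j)).resolve_left fun h0 => hj ?_⟩
    exact unique s t hst j i h0 hi'
  have root : ∀ i, ∃ s t : k, (s ≠ 0 ∨ t ≠ 0) ∧ s * α i + t * β i = 0 := by
    intro i
    refine ⟨β i, - α i, ?_, by ring⟩
    obtain ⟨j, hj⟩ : ∃ j, j ≠ i := exists_ne i
    by_contra hcon
    push Not at hcon
    have h2 : α i = 0 := by simpa using hcon.2
    exact hαβ j i hj (by rw [hcon.1, h2]; ring)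
  have nonzero : ∀ s t : k, (s ≠ 0 ∨ t ≠ 0) → P * Matrix.diagonal (s • α + t • β) * Q ≠ 0 := by
    intro s t hst h0
    have hd : Matrix.diagonal (s • α + t • β) = 0 := by
      have := congrArg (fun M => P⁻¹ * M * Q⁻¹) h0
      simpa [Matrix.mul_assoc, Matrix.mul_nonsing_inv _ (isUnit_iff_ne_zero.2 hQ),
        Matrix.nonsing_inv_mul_cancel_left _ _ (isUnit_iff_ne_zero.2 hP)] using this
    have hz : ∀ i, s * α i + t * β i = 0 := fun i => by
      simpa using congrFun (congrFun hd i) i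
    exact absurd (unique s t hst 0 1 (hz 0) (hz 1)) (by decide)
  have hP' : Pᵀ.det ≠ 0 := by simpa using hP
  have hQ' : Qᵀ.det ≠ 0 := by simpa using hQ
  obtain ⟨p, hpinj, hp⟩ := exists_points_of_det_ne_zero hQ
  obtain ⟨q, hqinj, hq⟩ := exists_points_of_det_ne_zero hP'
  have tr : ∀ d, (P * Matrix.diagonal d * Q)ᵀ = Qᵀ * Matrix.diagonal d * Pᵀ := by
    intro d
    simp [Matrix.transpose_mul, Matrix.mul_assoc]
  refine ⟨p, q, hpinj, hqinj, fun a => ?_, fun b => ?_, fun a b => ?_⟩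
  · simp only [crossProduct_eq_zero_iff_exists, ← Matrix.smul_mulVec, ← Matrix.add_mulVec, smul_add_smul_mul_diagonal_mul,
      mul_diagonal_mul_mulVec_eq_zero_iff hP, hp]
    constructor
    · rintro ⟨s, t, hst, h⟩
      obtain ⟨i, -, hi⟩ := single Q hQ a s t hst h
      exact ⟨i, hi⟩
    · rintro ⟨i, hi⟩
      obtain ⟨s, t, hst, h⟩ := root i
      refine ⟨s, t, hst, fun j => ?_⟩
      by_cases hj : j = i
      · subst hj; simp [h]
      · simp [hi j hj]
  · simp only [crossProduct_eq_zero_iff_exists, ← Matrix.smul_mulVec, ← Matrix.add_mulVec,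
      tr, smul_add_smul_mul_diagonal_mul,
      mul_diagonal_mul_mulVec_eq_zero_iff hQ', hq]
    constructor
    · rintro ⟨s, t, hst, h⟩
      obtain ⟨i, -, hi⟩ := single Pᵀ hP' b s t hst h
      exact ⟨i, hi⟩
    · rintro ⟨i, hi⟩
      obtain ⟨s, t, hst, h⟩ := root i
      refine ⟨s, t, hst, fun j => ?_⟩
      by_cases hj : j = i
      · subst hj; simp [h]
      · simp [hi j hj]
  · constructor
    · rintro ⟨H, hH, hH0, ha, hb⟩
      obtain ⟨s, t, rfl⟩ := Submodule.mem_span_pair.1 hH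
      have hst : s ≠ 0 ∨ t ≠ 0 := by
        by_contra hcon
        push Not at hcon
        exact hH0 (by simp [hcon.1, hcon.2])
      rw [smul_add_smul_mul_diagonal_mul, mul_diagonal_mul_mulVec_eq_zero_iff hP] at ha
      rw [smul_add_smul_mul_diagonal_mul, tr, mul_diagonal_mul_mulVec_eq_zero_iff hQ'] at hb
      obtain ⟨i, hi0, hi⟩ := single Q hQ a s t hst ha
      obtain ⟨j, hj0, hj⟩ := single Pᵀ hP' b s t hst hb
      -- Kernel and cokernel come from the same member, whose only zero diagonal entry forces equal
      -- indices.
      obtain rfl := unique s t hst i j hi0 hj0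
      exact ⟨i, (hp a i).2 hi, (hq b i).2 hj⟩
    · rintro ⟨i, ha, hb⟩
      rw [hp] at ha
      rw [hq] at hb
      obtain ⟨s, t, hst, h⟩ := root i
      refine ⟨_, Submodule.mem_span_pair.2 ⟨s, t, rfl⟩, ?_, ?_, ?_⟩
      · rw [smul_add_smul_mul_diagonal_mul]; exact nonzero s t hst
      · rw [smul_add_smul_mul_diagonal_mul, mul_diagonal_mul_mulVec_eq_zero_iff hP]
        intro j
        by_cases hj : j = i
        · subst hj; simp [h]
        · simp [ha j hj]
      · rw [smul_add_smul_mul_diagonal_mul, tr, mul_diagonal_mul_mulVec_eq_zero_iff hQ']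
        intro j
        by_cases hj : j = i
        · subst hj; simp [h]
        · simp [hb j hj]

/-- No nonzero linear form vanishes on all the vectors `F z × G z` of a split pencil. -/
theorem IsSplitPencil.eq_zero_of_dotProduct_crossProduct {F G : Matrix (Fin 3) (Fin 3) k}
    (h : IsSplitPencil F G) (c : Fin 3 → k)
    (hc : ∀ z, c ⬝ᵥ crossProduct (F *ᵥ z) (G *ᵥ z) = 0) : c = 0 := by
  obtain ⟨P, Q, α, β, hP, hQ, rfl, rfl, hαβ⟩ := h
  have hPu : IsUnit P.det := isUnit_iff_ne_zero.2 hP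
  have hQu : IsUnit Q.det := isUnit_iff_ne_zero.2 hQ
  obtain ⟨d, rfl⟩ : ∃ d, c = P *ᵥ d :=
    ⟨P⁻¹ *ᵥ c, by rw [Matrix.mulVec_mulVec, Matrix.mul_nonsing_inv _ hPu, Matrix.one_mulVec]⟩
  -- With `w = Q z`, this is the triple product identity `P d ⬝ (P x × P y) = det P * (d ⬝ (x ×
  -- y))`.
  have hw : ∀ w : Fin 3 → k, P.det * ((α 1 * β 2 - α 2 * β 1) * (d 0 * (w 1 * w 2)) +
      (α 2 * β 0 - α 0 * β 2) * (d 1 * (w 2 * w 0)) +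
      (α 0 * β 1 - α 1 * β 0) * (d 2 * (w 0 * w 1))) = 0 := by
    intro w
    have h1 := hc (Q⁻¹ *ᵥ w)
    have h2 : ∀ e, (P * Matrix.diagonal e * Q) *ᵥ (Q⁻¹ *ᵥ w) = P *ᵥ fun i => e i * w i := by
      intro e
      rw [Matrix.mulVec_mulVec, Matrix.mul_assoc, Matrix.mul_nonsing_inv _ hQu, Matrix.mul_one,
        ← Matrix.mulVec_mulVec]
      congr 1
      ext i
      simp [Matrix.mulVec_diagonal]
    rw [h2, h2] at h1
    rw [← h1, Matrix.det_fin_three, cross_apply]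
    simp only [Matrix.mulVec, dotProduct, Fin.sum_univ_three, Matrix.cons_val]
    ring
  -- A point with a single zero coordinate keeps just one of the three products of coordinates.
  have h0 : d 0 = 0 := by simpa [hP, hαβ 1 2 (by decide)] using hw ![0, 1, 1]
  have h1 : d 1 = 0 := by simpa [hP, hαβ 2 0 (by decide)] using hw ![1, 0, 1]
  have h2 : d 2 = 0 := by simpa [hP, hαβ 0 1 (by decide)] using hw ![1, 1, 0]
  have : d = 0 := by ext i; fin_cases i <;> assumption
  simp [this]

end Pencil

/-! ### Discriminant criterion for a split pencil -/

/-- The characteristic polynomial of a `3 × 3` matrix, as a cubic. -/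
def charCubic {R : Type*} [CommRing R] (S : Matrix (Fin 3) (Fin 3) R) : Cubic R :=
  ⟨1, -S.trace, S.adjugate.trace, -S.det⟩

theorem charCubic_toPoly_eval {R : Type*} [CommRing R] (S : Matrix (Fin 3) (Fin 3) R) (x : R) :
    (charCubic S).toPoly.eval x = (Matrix.scalar (Fin 3) x - S).det := by
  simp [charCubic, Cubic.toPoly, Matrix.det_fin_three, Matrix.trace_fin_three,
    Matrix.adjugate_fin_three]
  ring

theorem charCubic_diagonal_discr {R : Type*} [CommRing R] (x y z : R) :
    (charCubic (Matrix.diagonal ![x, y, z])).discr = ((x - y) * (x - z) * (y - z)) ^ 2 := by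
  rw [charCubic, Matrix.adjugate_fin_three, Matrix.det_fin_three, Matrix.trace_fin_three,
    Matrix.trace_fin_three]
  simp [Cubic.discr]
  ring

/-- `adj F * G` is `F⁻¹ G` scaled by `det F`, but polynomial in the entries. A nonzero discriminant
gives it three distinct eigenvalues `μ`, hence an eigenbasis `V`; then `P = F V`, `Q = V⁻¹`, `α = 1`
and `β = μ / det F`. -/
theorem isSplitPencil_of_discr_ne_zero {k : Type*} [Field k] [IsAlgClosed k]
    {F G : Matrix (Fin 3) (Fin 3) k} (hF : F.det ≠ 0)
    (hd : (charCubic (F.adjugate * G)).discr ≠ 0) : IsSplitPencil F G := by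
  set S := F.adjugate * G with hS
  have ha : (charCubic S).a ≠ 0 := one_ne_zero
  have hsplit : ((charCubic S).toPoly.map (RingHom.id k)).Splits := IsAlgClosed.splits _
  obtain ⟨x, y, z, h3⟩ := (Cubic.splits_iff_roots_eq_three ha).1 hsplit
  obtain ⟨hxy, hxz, hyz⟩ := (Cubic.discr_ne_zero_iff_roots_ne ha h3).1 hd
  have hroot : ∀ μ ∈ ({x, y, z} : Multiset k), ∃ v : Fin 3 → k, v ≠ 0 ∧ S *ᵥ v = μ • v := by
    intro μ hμ
    rw [← h3, Cubic.map_roots, Polynomial.map_id, Polynomial.mem_roots'] at hμ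
    have h0 := hμ.2
    rw [Polynomial.IsRoot, charCubic_toPoly_eval] at h0
    obtain ⟨v, hv, hv0⟩ := Matrix.exists_mulVec_eq_zero_iff.2 h0
    refine ⟨v, hv, ?_⟩
    rw [Matrix.sub_mulVec, sub_eq_zero] at hv0
    rw [← hv0]
    ext i
    simp [Matrix.mulVec_diagonal]
  set μ : Fin 3 → k := ![x, y, z] with hμ
  have hμinj : Function.Injective μ := by
    intro i j
    fin_cases i <;> fin_cases j <;> simp [hμ, hxy, hxz, hyz, hxy.symm, hxz.symm, hyz.symm]
  have hex : ∀ i, ∃ v : Fin 3 → k, v ≠ 0 ∧ S *ᵥ v = μ i • v := by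
    intro i
    apply hroot
    fin_cases i <;> simp [hμ]
  choose v hv0 hv using hex
  have hli : LinearIndependent k v := by
    refine Module.End.eigenvectors_linearIndependent' (Matrix.toLin' S) μ hμinj v fun i => ?_
    rw [Module.End.hasEigenvector_iff, Module.End.mem_eigenspace_iff]
    exact ⟨by simpa using hv i, hv0 i⟩
  set V : Matrix (Fin 3) (Fin 3) k := (Matrix.of v)ᵀ with hV
  have hVu : IsUnit V := by
    rw [← Matrix.linearIndependent_cols_iff_isUnit]
    exact hli
  have hVd : IsUnit V.det := (Matrix.isUnit_iff_isUnit_det V).1 hVu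
  have hSV : S * V = V * Matrix.diagonal μ := by
    ext i j
    rw [Matrix.mul_diagonal]
    have := congrFun (hv j) i
    rw [Pi.smul_apply, smul_eq_mul, mul_comm] at this
    exact this
  have hFS : F * S = F.det • G := by
    rw [hS, ← Matrix.mul_assoc, Matrix.mul_adjugate, Matrix.smul_mul, Matrix.one_mul]
  refine ⟨F * V, V⁻¹, fun _ => 1, fun i => F.det⁻¹ * μ i, ?_, ?_, ?_, ?_, ?_⟩
  · rw [Matrix.det_mul]
    exact mul_ne_zero hF hVd.ne_zero
  · rw [Matrix.det_nonsing_inv, Ring.inverse_eq_inv']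
    exact inv_ne_zero hVd.ne_zero
  · rw [Matrix.diagonal_one, Matrix.mul_one, Matrix.mul_assoc, Matrix.mul_nonsing_inv _ hVd,
      Matrix.mul_one]
  · have : Matrix.diagonal (fun i => F.det⁻¹ * μ i) = F.det⁻¹ • Matrix.diagonal μ := by
      rw [← Matrix.diagonal_smul]; rfl
    rw [this, Matrix.mul_smul, Matrix.mul_assoc, ← hSV, Matrix.smul_mul, ← Matrix.mul_assoc, hFS,
      Matrix.mul_assoc, Matrix.mul_nonsing_inv _ hVd, Matrix.mul_one, smul_smul,
      inv_mul_cancel₀ hF, one_smul]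
  · intro i j hij
    simp only [one_mul, ← mul_sub]
    exact mul_ne_zero (inv_ne_zero hF) (sub_ne_zero.2 fun h => hij (hμinj h).symm)

/-! ### A basis of the solution space, polynomial in the data -/

section Design

variable {R : Type*} [CommRing R]

/-- The entries of a `3 × 3` matrix, listed row by row. -/
def entryEquiv : Fin 7 ⊕ Fin 2 ≃ Fin 3 × Fin 3 :=
  (finSumFinEquiv (m := 7) (n := 2)).trans (finProdFinEquiv (m := 3) (n := 3)).symm

/-- The linear forms `F ↦ vᵢᵀ F uᵢ`, completed by `F₀₀` and `F₁₁ - F₀₀`, as coefficient matrices. -/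
def designForm (u v : Fin 7 → Fin 3 → R) : Fin 7 ⊕ Fin 2 → Matrix (Fin 3) (Fin 3) R :=
  Sum.elim (fun i => Matrix.vecMulVec (v i) (u i))
    -- Completing by `F₁₁ - F₀₀` instead of `F₁₁` makes the first solution `diag(D, D, -2D)` at the
    -- test configuration; `F₁₁` would give the singular `diag(D, 0, -D)`.
    ![!![1, 0, 0; 0, 0, 0; 0, 0, 0], !![-1, 0, 0; 0, 1, 0; 0, 0, 0]]

/-- The square matrix of the completed linear system. -/
def designMatrix (u v : Fin 7 → Fin 3 → R) : Matrix (Fin 7 ⊕ Fin 2) (Fin 7 ⊕ Fin 2) R :=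
  Matrix.of fun r s => designForm u v r (entryEquiv s).1 (entryEquiv s).2

/-- A column of the adjugate, a solution of the linear system. -/
def designSolution (u v : Fin 7 → Fin 3 → R) (j : Fin 2) : Matrix (Fin 3) (Fin 3) R :=
  Matrix.of fun a b => (designMatrix u v).adjugate (entryEquiv.symm (a, b)) (Sum.inr j)

/-- The polynomial whose nonvanishing makes a configuration generic. -/
def designDiscr (u v : Fin 7 → Fin 3 → R) : R :=
  (designMatrix u v).det * (designSolution u v 0).det *
    (charCubic ((designSolution u v 0).adjugate * designSolution u v 1)).discr

theorem designMatrix_mulVec (u v : Fin 7 → Fin 3 → R) (F : Matrix (Fin 3) (Fin 3) R)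
    (r : Fin 7 ⊕ Fin 2) :
    (designMatrix u v *ᵥ fun s => F (entryEquiv s).1 (entryEquiv s).2) r =
      ∑ a, ∑ b, designForm u v r a b * F a b := by
  rw [← Fintype.sum_prod_type', ← entryEquiv.sum_comp]
  rfl

theorem designMatrix_mulVec_inl (u v : Fin 7 → Fin 3 → R) (F : Matrix (Fin 3) (Fin 3) R)
    (i : Fin 7) :
    (designMatrix u v *ᵥ fun s => F (entryEquiv s).1 (entryEquiv s).2) (Sum.inl i) =
      v i ⬝ᵥ (F *ᵥ u i) := by
  rw [designMatrix_mulVec]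
  simp only [designForm, Sum.elim_inl, Matrix.vecMulVec_apply, dotProduct, Matrix.mulVec,
    Finset.mul_sum]
  exact Finset.sum_congr rfl fun a _ => Finset.sum_congr rfl fun b _ => by ring

theorem designMatrix_mulVec_inr (u v : Fin 7 → Fin 3 → R) (F : Matrix (Fin 3) (Fin 3) R)
    (j : Fin 2) :
    (designMatrix u v *ᵥ fun s => F (entryEquiv s).1 (entryEquiv s).2) (Sum.inr j) =
      ![F 0 0, F 1 1 - F 0 0] j := by
  rw [designMatrix_mulVec]
  fin_cases j <;> simp [designForm, Fin.sum_univ_three]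
  ring

/-- This is a column of `M * adj M = det M • 1`: the seven data forms vanish, and one completing
form takes the value `det M`. -/
theorem designMatrix_mulVec_designSolution (u v : Fin 7 → Fin 3 → R) (j : Fin 2) :
    (designMatrix u v *ᵥ
      fun s => designSolution u v j (entryEquiv s).1 (entryEquiv s).2) =
      Pi.single (Sum.inr j) (designMatrix u v).det := by
  have h : (fun s => designSolution u v j (entryEquiv s).1 (entryEquiv s).2) =
      fun s => (designMatrix u v).adjugate s (Sum.inr j) := by
    ext s
    simp [designSolution]
  rw [h]
  ext r
  have := congrFun (congrFun (Matrix.mul_adjugate (designMatrix u v)) r) (Sum.inr j)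
  rw [Matrix.smul_apply, Matrix.one_apply, smul_eq_mul, mul_ite, mul_one, mul_zero] at this
  rw [Pi.single_apply]
  exact this

theorem dotProduct_designSolution_mulVec (u v : Fin 7 → Fin 3 → R) (j : Fin 2) (i : Fin 7) :
    v i ⬝ᵥ (designSolution u v j *ᵥ u i) = 0 := by
  rw [← designMatrix_mulVec_inl, designMatrix_mulVec_designSolution]
  simp

theorem designSolution_normalized (u v : Fin 7 → Fin 3 → R) :
    designSolution u v 0 0 0 = (designMatrix u v).det ∧
    designSolution u v 0 1 1 = (designMatrix u v).det ∧
    designSolution u v 1 0 0 = 0 ∧ designSolution u v 1 1 1 = (designMatrix u v).det := by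
  have h := fun i j => (designMatrix_mulVec_inr u v (designSolution u v j) i).symm.trans
    (congrFun (designMatrix_mulVec_designSolution u v j) (Sum.inr i))
  have h00 := h 0 0
  have h10 := h 1 0
  have h01 := h 0 1
  have h11 := h 1 1
  simp at h00 h10 h01 h11
  rw [h01, sub_zero] at h11
  exact ⟨h00, (sub_eq_zero.1 h10).trans h00, h01, h11⟩

theorem map_designMatrix {T : Type*} [CommRing T] (φ : R →+* T) (u v : Fin 7 → Fin 3 → R) :
    (designMatrix u v).map φ = designMatrix (fun i j => φ (u i j)) fun i j => φ (v i j) := by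
  ext r s
  rcases r with i | j
  · simp [designMatrix, designForm, Matrix.vecMulVec_apply]
  · simp only [designMatrix, designForm, Matrix.map_apply, Matrix.of_apply, Sum.elim_inr]
    generalize entryEquiv s = p
    obtain ⟨a, b⟩ := p
    fin_cases j <;> fin_cases a <;> fin_cases b <;> simp

theorem map_designSolution {T : Type*} [CommRing T] (φ : R →+* T) (u v : Fin 7 → Fin 3 → R)
    (j : Fin 2) : (designSolution u v j).map φ =
      designSolution (fun i j => φ (u i j)) (fun i j => φ (v i j)) j := by
  ext a b
  have h := RingHom.map_adjugate φ (designMatrix u v)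
  rw [RingHom.mapMatrix_apply, RingHom.mapMatrix_apply, map_designMatrix] at h
  exact congrFun (congrFun h _) _

/-- Only ring operations enter the construction. This serves both to evaluate the generic polynomial
at coordinates and to pass from `K` to `ℂ`. -/
theorem map_designDiscr {T : Type*} [CommRing T] (φ : R →+* T) (u v : Fin 7 → Fin 3 → R) :
    φ (designDiscr u v) = designDiscr (fun i j => φ (u i j)) fun i j => φ (v i j) := by
  have hc : ∀ S : Matrix (Fin 3) (Fin 3) R,
      φ (charCubic S).discr = (charCubic (S.map φ)).discr := by
    intro S
    have ht : ∀ M : Matrix (Fin 3) (Fin 3) R, φ M.trace = (M.map φ).trace := fun M => by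
      simp [Matrix.trace_fin_three]
    have hd : φ S.det = (S.map φ).det := RingHom.map_det φ S
    have ha : S.adjugate.map φ = (S.map φ).adjugate := RingHom.map_adjugate φ S
    simp [charCubic, Cubic.discr, hd, ← ha, ← ht, map_ofNat φ]
  have ha : (designSolution u v 0).adjugate.map φ = ((designSolution u v 0).map φ).adjugate :=
    RingHom.map_adjugate φ _
  rw [designDiscr, map_mul, map_mul, RingHom.map_det, RingHom.map_det, RingHom.mapMatrix_apply,
    RingHom.mapMatrix_apply, map_designMatrix, map_designSolution, hc, Matrix.map_mul, ha,
    map_designSolution, map_designSolution]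
  rfl

end Design

/-! ### Dimension two, and a configuration where the polynomial is nonzero -/

section Field

variable {k : Type*} [Field k]

theorem eq_zero_of_designMatrix_det_ne_zero {u v : Fin 7 → Fin 3 → k}
    (hD : (designMatrix u v).det ≠ 0) {F : Matrix (Fin 3) (Fin 3) k}
    (hF : ∀ i, v i ⬝ᵥ (F *ᵥ u i) = 0) (h0 : F 0 0 = 0) (h1 : F 1 1 = 0) : F = 0 := by
  have h := Matrix.eq_zero_of_mulVec_eq_zero hD
    (v := fun s => F (entryEquiv s).1 (entryEquiv s).2) (by
      ext r
      rcases r with i | j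
      · rw [designMatrix_mulVec_inl, hF]; rfl
      · rw [designMatrix_mulVec_inr]
        fin_cases j <;> simp [h0, h1])
  ext a b
  simpa using congrFun h (entryEquiv.symm (a, b))

theorem mem_span_designSolution_iff {u v : Fin 7 → Fin 3 → k} (hD : (designMatrix u v).det ≠ 0)
    (F : Matrix (Fin 3) (Fin 3) k) :
    F ∈ Submodule.span k {designSolution u v 0, designSolution u v 1} ↔
      ∀ i, v i ⬝ᵥ (F *ᵥ u i) = 0 := by
  rw [Submodule.mem_span_pair]
  constructor
  · rintro ⟨s, t, rfl⟩ i
    simp [Matrix.add_mulVec, Matrix.smul_mulVec, dotProduct_designSolution_mulVec]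
  · intro hF
    obtain ⟨h1, h2, h3, h4⟩ := designSolution_normalized u v
    -- The coefficients match the entries `F₀₀` and `F₁₁`, which determine a solution.
    refine ⟨F 0 0 / (designMatrix u v).det, (F 1 1 - F 0 0) / (designMatrix u v).det, ?_⟩
    rw [eq_comm, ← sub_eq_zero]
    apply eq_zero_of_designMatrix_det_ne_zero hD
    · intro i
      simp [Matrix.sub_mulVec, Matrix.add_mulVec, Matrix.smul_mulVec,
        dotProduct_designSolution_mulVec, hF]
    · simp [h1, h3, hD]
    · simp [h2, h4, hD]

theorem linearIndependent_designSolution {u v : Fin 7 → Fin 3 → k}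
    (hD : (designMatrix u v).det ≠ 0) :
    LinearIndependent k ![designSolution u v 0, designSolution u v 1] := by
  obtain ⟨h1, h2, h3, h4⟩ := designSolution_normalized u v
  rw [LinearIndependent.pair_iff]
  intro s t h
  have e0 : s = 0 := by simpa [h1, h3, hD] using congrFun (congrFun h 0) 0
  have e1 := congrFun (congrFun h 1) 1
  refine ⟨e0, ?_⟩
  simpa [h2, h4, hD, e0] using e1

/-- Six pairs of distinct coordinate points and the unit point: the solution space is that of
diagonal matrices of trace zero. -/
theorem exists_designDiscr_ne_zero [CharZero k] :
    ∃ u v : Fin 7 → Fin 3 → k, designDiscr u v ≠ 0 := by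
  let u : Fin 7 → Fin 3 → k := ![![1, 0, 0], ![1, 0, 0], ![0, 1, 0], ![0, 1, 0], ![0, 0, 1],
    ![0, 0, 1], ![1, 1, 1]]
  let v : Fin 7 → Fin 3 → k := ![![0, 1, 0], ![0, 0, 1], ![1, 0, 0], ![0, 0, 1], ![1, 0, 0],
    ![0, 1, 0], ![1, 1, 1]]
  have hsol : ∀ F : Matrix (Fin 3) (Fin 3) k, (∀ i, v i ⬝ᵥ (F *ᵥ u i) = 0) →
      F = Matrix.diagonal ![F 0 0, F 1 1, -(F 0 0 + F 1 1)] := by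
    intro F h
    have e0 := h 0
    have e1 := h 1
    have e2 := h 2
    have e3 := h 3
    have e4 := h 4
    have e5 := h 5
    have e6 := h 6
    simp [u, v, dotProduct, Matrix.mulVec, Fin.sum_univ_three] at e0 e1 e2 e3 e4 e5 e6
    rw [e0, e1, e2, e3, e4, e5] at e6
    have e7 : F 2 2 = -(F 0 0 + F 1 1) := by linear_combination e6
    ext i j
    fin_cases i <;> fin_cases j <;> simp [*]
  -- A kernel vector is a trace-zero diagonal matrix with `F₀₀ = F₁₁ = 0`, hence zero.
  have hD : (designMatrix u v).det ≠ 0 := by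
    intro h0
    obtain ⟨w, hw0, hw⟩ := Matrix.exists_mulVec_eq_zero_iff.2 h0
    set F : Matrix (Fin 3) (Fin 3) k := Matrix.of fun a b => w (entryEquiv.symm (a, b)) with hF
    have hwF : w = fun s => F (entryEquiv s).1 (entryEquiv s).2 := by
      ext s; simp [hF]
    rw [hwF] at hw
    have h1 := hsol F fun i => by rw [← designMatrix_mulVec_inl, hw]; rfl
    have h2 : F 0 0 = 0 := by
      simpa [designMatrix_mulVec_inr] using congrFun hw (Sum.inr 0)
    have h3 : F 1 1 = 0 := by
      simpa [designMatrix_mulVec_inr, h2] using congrFun hw (Sum.inr 1)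
    apply hw0
    rw [hwF, h1, h2, h3]
    ext s
    generalize entryEquiv s = p
    obtain ⟨a, b⟩ := p
    fin_cases a <;> fin_cases b <;> simp
  obtain ⟨h1, h2, h3, h4⟩ := designSolution_normalized u v
  have hs0 := hsol _ (dotProduct_designSolution_mulVec u v 0)
  have hs1 := hsol _ (dotProduct_designSolution_mulVec u v 1)
  rw [h1, h2] at hs0
  rw [h3, h4] at hs1
  refine ⟨u, v, ?_⟩
  rw [designDiscr, hs0, hs1]
  generalize (designMatrix u v).det = D at hD
  refine mul_ne_zero (mul_ne_zero hD ?_) ?_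
  · rw [Matrix.det_diagonal, Fin.prod_univ_three]
    have : (D + D) ≠ 0 := by rw [← two_mul]; exact mul_ne_zero two_ne_zero hD
    simp [hD, neg_eq_zero, -neg_add_rev, this]
  -- The eigenvalues `0`, `-2D³`, `-D³` are distinct in characteristic zero.
  · have : (Matrix.diagonal ![D, D, -(D + D)]).adjugate * Matrix.diagonal ![0, D, -(0 + D)] =
        Matrix.diagonal ![0, -2 * D ^ 3, - D ^ 3] := by
      rw [Matrix.adjugate_fin_three]
      ext i j
      fin_cases i <;> fin_cases j <;> simp <;> ring
    rw [this, charCubic_diagonal_discr]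
    refine pow_ne_zero _ ?_
    have h : (0 - -2 * D ^ 3) * (0 - -D ^ 3) * (-2 * D ^ 3 - -D ^ 3) = -2 * D ^ 9 := by ring
    rw [h]
    exact mul_ne_zero (neg_ne_zero.2 two_ne_zero) (pow_ne_zero _ hD)

end Field

/-! ### Center pairs and base change to the complex numbers -/

section Points

variable {K : Type*} [Field K]

theorem mem_matrixSpace_mk_iff {n : ℕ} (u v : Fin n → Fin 3 → K) (hu : ∀ i, u i ≠ 0)
    (hv : ∀ i, v i ≠ 0) (F : Matrix (Fin 3) (Fin 3) K) :
    F ∈ matrixSpace (fun i => Projectivization.mk K (u i) (hu i))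
      (fun i => Projectivization.mk K (v i) (hv i)) ↔ ∀ i, v i ⬝ᵥ (F *ᵥ u i) = 0 := by
  refine forall_congr' fun i => ?_
  obtain ⟨c, hc⟩ := Projectivization.exists_smul_eq_mk_rep K (u i) (hu i)
  obtain ⟨d, hd⟩ := Projectivization.exists_smul_eq_mk_rep K (v i) (hv i)
  rw [← hc, ← hd]
  simp [Units.smul_def, Matrix.mulVec_smul]

/-- The centers of two cameras agreeing on the data are the kernel and the cokernel of the
matrix `F = Bᵀ J A`, where `J` is the standard symplectic matrix. -/
theorem IsCenterPair.mem_centersVariety {n : ℕ} {X Y : Fin n → Plane K} {a b : Plane K}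
    (h : IsCenterPair X Y a b) : (a, b) ∈ centersVariety X Y := by
  obtain ⟨A, B, hA, hB, ha, hb, hi⟩ := h
  let J : Matrix (Fin 2) (Fin 2) K := !![0, 1; -1, 0]
  refine ⟨Bᵀ * J * A, fun i => ?_, fun h0 => ?_, ?_, ?_⟩
  -- `yᵀ F x = (B y)ᵀ J (A x)` vanishes because `A x` and `B y` are proportional and `J` is
  -- alternating.
  · obtain ⟨-, -, c, -, hc⟩ := hi i
    rw [← Matrix.mulVec_mulVec, ← Matrix.mulVec_mulVec, Matrix.dotProduct_mulVec,
      Matrix.vecMul_transpose, hc]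
    simp [J, Matrix.mulVec, dotProduct]
    ring
  -- Rank 2 makes `A` and `B` surjective, so some `x`, `y` give `(B y)ᵀ J (A x) = 1`.
  · have hrank : ∀ M : Matrix (Fin 2) (Fin 3) K, M.rank = 2 → ∀ y, ∃ x, M *ᵥ x = y := by
      intro M hM y
      have : LinearMap.range M.mulVecLin = ⊤ :=
        Submodule.eq_top_of_finrank_eq (by simpa [Matrix.rank] using hM)
      exact LinearMap.range_eq_top.1 this y
    obtain ⟨x, hx⟩ := hrank A hA ![0, 1]
    obtain ⟨y, hy⟩ := hrank B hB ![1, 0]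
    have : y ⬝ᵥ ((Bᵀ * J * A) *ᵥ x) = 1 := by
      rw [← Matrix.mulVec_mulVec, ← Matrix.mulVec_mulVec, Matrix.dotProduct_mulVec,
        Matrix.vecMul_transpose, hx, hy]
      simp [J, Matrix.vecHead, Matrix.vecTail]
    simp [h0] at this
  · rw [← Matrix.mulVec_mulVec, ha, Matrix.mulVec_zero]
  · rw [Matrix.transpose_mul, Matrix.transpose_mul, Matrix.transpose_transpose,
      ← Matrix.mulVec_mulVec, ← Matrix.mulVec_mulVec, hb, Matrix.mulVec_zero, Matrix.mulVec_zero]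

variable [Algebra K ℂ]

theorem algebraMap_comp_ne_zero {u : Fin 3 → K} (hu : u ≠ 0) :
    (fun j => algebraMap K ℂ (u j)) ≠ 0 := by
  intro h
  apply hu
  ext j
  simpa using congrFun h j

theorem toComplex_mk (u : Fin 3 → K) (hu : u ≠ 0) :
    toComplex (Projectivization.mk K u hu) =
      Projectivization.mk ℂ (fun j => algebraMap K ℂ (u j)) (algebraMap_comp_ne_zero hu) := by
  obtain ⟨c, hc⟩ := Projectivization.exists_smul_eq_mk_rep K u hu
  rw [toComplex, Projectivization.mk_eq_mk_iff']
  refine ⟨algebraMap K ℂ c, ?_⟩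
  ext j
  simp [← hc, Units.smul_def]

theorem exists_smul_eq_toComplex_rep (a : Plane K) :
    ∃ c : ℂ, (c • fun j => algebraMap K ℂ (a.rep j)) = (toComplex a).rep := by
  obtain ⟨c, hc⟩ := Projectivization.exists_smul_eq_mk_rep ℂ _
    (algebraMap_comp_ne_zero a.rep_nonzero)
  exact ⟨c, hc⟩

/-- A complex ratio between two vectors over `K` is a quotient of coordinates, hence already in `K`.
-/
theorem toComplex_injective : Function.Injective (toComplex (K := K)) := by
  intro a b h
  obtain ⟨c, hc⟩ := (Projectivization.mk_eq_mk_iff' ..).1 h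
  obtain ⟨j, hj⟩ := Function.ne_iff.1 b.rep_nonzero
  rw [← a.mk_rep, ← b.mk_rep, Projectivization.mk_eq_mk_iff']
  have hj' : algebraMap K ℂ (b.rep j) ≠ 0 := by simpa using hj
  refine ⟨a.rep j / b.rep j, ?_⟩
  ext i
  apply (algebraMap K ℂ).injective
  have h1 := congrFun hc i
  have h2 := congrFun hc j
  simp only [Pi.smul_apply, smul_eq_mul] at h1 h2 ⊢
  rw [map_mul, map_div₀, ← h1, ← h2, mul_div_cancel_right₀ _ hj']

theorem map_mulVec_algebraMap (F : Matrix (Fin 3) (Fin 3) K) (x : Fin 3 → K) :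
    (F.map (algebraMap K ℂ) *ᵥ fun j => algebraMap K ℂ (x j)) =
      fun i => algebraMap K ℂ ((F *ᵥ x) i) := by
  ext i
  exact (RingHom.map_mulVec (algebraMap K ℂ) F x i).symm

theorem map_mulVec_toComplex_rep_eq_zero {F : Matrix (Fin 3) (Fin 3) K} {a : Plane K}
    (h : F *ᵥ a.rep = 0) : F.map (algebraMap K ℂ) *ᵥ (toComplex a).rep = 0 := by
  obtain ⟨c, hc⟩ := exists_smul_eq_toComplex_rep a
  rw [← hc, Matrix.mulVec_smul, map_mulVec_algebraMap, h]
  ext i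
  simp

theorem toComplex_mem_complexCentersVariety {n : ℕ} {X Y : Fin n → Plane K} {a b : Plane K}
    (h : (a, b) ∈ centersVariety X Y) :
    (toComplex a, toComplex b) ∈ complexCentersVariety X Y := by
  obtain ⟨F, hF, hF0, ha, hb⟩ := h
  refine ⟨F.map (algebraMap K ℂ), fun i => ?_, fun h0 => hF0 ?_,
    map_mulVec_toComplex_rep_eq_zero ha, ?_⟩
  · obtain ⟨c, hc⟩ := exists_smul_eq_toComplex_rep (X i)
    obtain ⟨d, hd⟩ := exists_smul_eq_toComplex_rep (Y i)
    have h1 : (fun j => algebraMap K ℂ ((Y i).rep j)) ⬝ᵥ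
        (fun j => algebraMap K ℂ ((F *ᵥ (X i).rep) j)) = 0 := by
      rw [← map_zero (algebraMap K ℂ), ← hF i, RingHom.map_dotProduct]
      rfl
    dsimp only
    rw [← hc, ← hd, Matrix.mulVec_smul, map_mulVec_algebraMap, dotProduct_smul, smul_dotProduct,
      h1, smul_zero, smul_zero]
  · ext i j
    simpa using congrFun (congrFun h0 i) j
  · rw [← Matrix.transpose_map]
    exact map_mulVec_toComplex_rep_eq_zero hb

end Points

/-! ### The conics as polynomials -/

section Conics

variable {K : Type*} [Field K]

theorem linearForms_isHomogeneous (F : Matrix (Fin 3) (Fin 3) K) (i : Fin 3) :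
    (linearForms F i).IsHomogeneous 1 := by
  simp only [linearForms, Matrix.mulVec, dotProduct, Matrix.map_apply]
  refine MvPolynomial.IsHomogeneous.sum _ _ _ fun j _ => ?_
  exact (MvPolynomial.isHomogeneous_X K j).C_mul _

theorem crossConics_isHomogeneous (F G : Matrix (Fin 3) (Fin 3) K) (i : Fin 3) :
    (crossConics F G i).IsHomogeneous 2 := by
  have h : ∀ a b c d, (linearForms F a * linearForms G b -
      linearForms F c * linearForms G d).IsHomogeneous 2 := fun a b c d =>
    ((linearForms_isHomogeneous F a).mul (linearForms_isHomogeneous G b)).sub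
      ((linearForms_isHomogeneous F c).mul (linearForms_isHomogeneous G d))
  rw [crossConics, cross_apply]
  fin_cases i <;> exact h _ _ _ _

variable [Algebra K ℂ]

theorem aeval_linearForms (F : Matrix (Fin 3) (Fin 3) K) (z : Fin 3 → ℂ) (i : Fin 3) :
    MvPolynomial.aeval z (linearForms F i) = (F.map (algebraMap K ℂ) *ᵥ z) i := by
  simp [linearForms, Matrix.mulVec, dotProduct]

theorem aeval_crossConics (F G : Matrix (Fin 3) (Fin 3) K) (z : Fin 3 → ℂ) (i : Fin 3) :
    MvPolynomial.aeval z (crossConics F G i) = crossProduct (F.map (algebraMap K ℂ) *ᵥ z)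
      (G.map (algebraMap K ℂ) *ᵥ z) i := by
  rw [crossConics, cross_apply, cross_apply]
  fin_cases i <;> simp [aeval_linearForms]

theorem mem_complexIntersection_crossConics_iff (F G : Matrix (Fin 3) (Fin 3) K) (a : Plane ℂ) :
    a ∈ complexIntersection (crossConics F G) ↔
      crossProduct (F.map (algebraMap K ℂ) *ᵥ a.rep) (G.map (algebraMap K ℂ) *ᵥ a.rep) = 0 := by
  simp [complexIntersection, aeval_crossConics, funext_iff]

/-- All three conics are linearly independent: a relation over `K`, evaluated at complex `z`, is a
linear form vanishing on every `F z × G z`. -/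
theorem isConicTriple_crossConics {F G : Matrix (Fin 3) (Fin 3) K}
    (h : IsSplitPencil (F.map (algebraMap K ℂ)) (G.map (algebraMap K ℂ))) :
    IsConicTriple (crossConics F G) := by
  have hli : LinearIndependent K (crossConics F G) := by
    rw [Fintype.linearIndependent_iff]
    intro c hc
    have h0 := h.eq_zero_of_dotProduct_crossProduct (fun i => algebraMap K ℂ (c i)) fun z => by
      have := congrArg (MvPolynomial.aeval z) hc
      simpa [aeval_crossConics, Algebra.smul_def, dotProduct] using this
    intro i
    simpa using congrFun h0 i
  refine ⟨fun i => ⟨crossConics_isHomogeneous F G i, hli.ne_zero i⟩, fun i j hij => ?_⟩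
  have := hli.comp ![i, j] (by
    intro x y
    fin_cases x <;> fin_cases y <;> simp [hij, hij.symm])
  convert this using 1
  ext x
  fin_cases x <;> rfl

end Conics

/-! ### Counting and assembly -/

theorem span_pair_change_basis {k M : Type*} [Field k] [AddCommGroup M] [Module k M]
    {p q r s : k} (hd : p * s - q * r ≠ 0) (f g : M) :
    Submodule.span k {p • f + q • g, r • f + s • g} = Submodule.span k {f, g} := by
  have hd' : (p * s - q * r)⁻¹ * (p * s - q * r) = 1 := inv_mul_cancel₀ hd
  set d := (p * s - q * r)⁻¹
  apply le_antisymm <;> rw [Submodule.span_le, Set.pair_subset_iff] <;>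
    simp only [SetLike.mem_coe, Submodule.mem_span_pair]
  · exact ⟨⟨p, q, rfl⟩, ⟨r, s, rfl⟩⟩
  · refine ⟨⟨d * s, -(d * q), ?_⟩, ⟨-(d * r), d * p, ?_⟩⟩
    · linear_combination (norm := module) hd' • f
    · linear_combination (norm := module) hd' • g

theorem encard_range_fin {α : Type*} {n : ℕ} {f : Fin n → α} (hf : Function.Injective f) :
    (Set.range f).encard = n := by
  rw [← Set.image_univ, hf.encard_image, Set.encard_univ]
  simp

theorem hasMultidegree_zero_zero {V : Set (Plane ℂ × Plane ℂ)} {d : ℕ} (h : V.encard = d) :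
    HasMultidegree V 0 0 d := by
  refine ⟨1, one_ne_zero, fun l m _ => ?_⟩
  rw [← h]
  congr 1
  ext p
  simp

end FlatlandCameras

/-- `K` is a field of definition of the data inside `ℂ`; the cases of interest are `ℝ` and `ℂ`. -/
theorem mainTheorem6 (K : Type*) [Field K] [Algebra K ℂ] :
    HoldsGenerically 7 fun X Y : Fin 7 → Plane K =>
      -- the conics are computed from any basis of the two-dimensional solution space of the
      -- linear system given by the data
      Module.finrank K (matrixSpace X Y) = 2 ∧
      (∀ F₁ F₂ : Matrix (Fin 3) (Fin 3) K, LinearIndependent K ![F₁, F₂] →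
        Submodule.span K {F₁, F₂} = matrixSpace X Y →
        IsConicTriple (crossConics F₁ F₂) ∧
        IsConicTriple (crossConics F₁ᵀ F₂ᵀ) ∧
        (∀ a b, IsCenterPair X Y a b →
          toComplex a ∈ complexIntersection (crossConics F₁ F₂) ∧
          toComplex b ∈ complexIntersection (crossConics F₁ᵀ F₂ᵀ)) ∧
        (complexIntersection (crossConics F₁ F₂)).encard = 3 ∧
        (complexIntersection (crossConics F₁ᵀ F₂ᵀ)).encard = 3 ∧
        (∀ a b, (a, b) ∈ complexCentersVariety X Y → a ∈ complexIntersection (crossConics F₁ F₂) ∧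
          b ∈ complexIntersection (crossConics F₁ᵀ F₂ᵀ)) ∧
        (∀ a ∈ complexIntersection (crossConics F₁ F₂), ∃! b, (a, b) ∈ complexCentersVariety X Y) ∧
        (∀ b ∈ complexIntersection (crossConics F₁ᵀ F₂ᵀ), ∃! a, (a, b) ∈ complexCentersVariety X Y)) ∧
      -- one center determines the other
      (∀ a b b', IsCenterPair X Y a b →
        IsCenterPair X Y a b' → b = b') ∧
      (∀ a a' b, IsCenterPair X Y a b →
        IsCenterPair X Y a' b → a = a') ∧
      -- the camera centers variety
      (∀ a b, IsCenterPair X Y a b →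
        (toComplex a, toComplex b) ∈ complexCentersVariety X Y) ∧
      (complexCentersVariety X Y).encard = 3 ∧ HasMultidegree (complexCentersVariety X Y) 0 0 3 ∧
      {p : Plane K × Plane K |
        IsCenterPair X Y p.1 p.2}.encard ≤ 3 := by
  have : CharZero K := (algebraMap K ℂ).charZero
  -- The polynomial is `designDiscr` of the configuration whose coordinates are the indeterminates.
  refine ⟨designDiscr (fun i j => MvPolynomial.X (Sum.inl (i, j)))
    (fun i j => MvPolynomial.X (Sum.inr (i, j))), fun h0 => ?_, fun u v hu hv hΔ => ?_⟩
  · obtain ⟨u, v, huv⟩ := exists_designDiscr_ne_zero (k := K)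
    apply huv
    have := congrArg (MvPolynomial.eval (Sum.elim (fun s => u s.1 s.2) (fun s => v s.1 s.2))) h0
    simpa [map_designDiscr] using this
  rw [map_designDiscr] at hΔ
  simp only [MvPolynomial.eval_X, Sum.elim_inl, Sum.elim_inr] at hΔ
  set X : Fin 7 → Plane K := fun i => Projectivization.mk K (u i) (hu i) with hX
  set Y : Fin 7 → Plane K := fun i => Projectivization.mk K (v i) (hv i) with hY
  set u' : Fin 7 → Fin 3 → ℂ := fun i j => algebraMap K ℂ (u i j) with hu'
  set v' : Fin 7 → Fin 3 → ℂ := fun i j => algebraMap K ℂ (v i j) with hv'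
  have hΔ' : designDiscr u' v' ≠ 0 := by
    rw [← map_designDiscr (algebraMap K ℂ)]
    simpa using hΔ
  have hD : (designMatrix u v).det ≠ 0 := left_ne_zero_of_mul (left_ne_zero_of_mul hΔ)
  have hD' : (designMatrix u' v').det ≠ 0 := left_ne_zero_of_mul (left_ne_zero_of_mul hΔ')
  have hspan : Submodule.span K {designSolution u v 0, designSolution u v 1} = matrixSpace X Y := by
    ext F
    rw [mem_span_designSolution_iff hD, mem_matrixSpace_mk_iff]
  have hspan' : Submodule.span ℂ {designSolution u' v' 0, designSolution u' v' 1} =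
      matrixSpace (fun i => toComplex (X i)) fun i => toComplex (Y i) := by
    ext F
    simp only [hX, hY, toComplex_mk]
    rw [mem_span_designSolution_iff hD', mem_matrixSpace_mk_iff]
  have hsplit : IsSplitPencil (designSolution u' v' 0) (designSolution u' v' 1) :=
    isSplitPencil_of_discr_ne_zero (right_ne_zero_of_mul (left_ne_zero_of_mul hΔ'))
      (right_ne_zero_of_mul hΔ')
  have hcp : ∀ a b, IsCenterPair X Y a b →
      (toComplex a, toComplex b) ∈ complexCentersVariety X Y := fun a b h =>
    toComplex_mem_complexCentersVariety h.mem_centersVariety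
  obtain ⟨p, q, hp, hq, -, -, hE⟩ := hsplit.exists_points
  rw [hspan'] at hE
  have hmem : ∀ a b, (a, b) ∈ complexCentersVariety X Y ↔ ∃ i, a = p i ∧ b = q i := hE
  have hcard : (complexCentersVariety X Y).encard = 3 := by
    have : complexCentersVariety X Y = Set.range fun i => (p i, q i) := by
      ext ⟨a, b⟩
      rw [hmem, Set.mem_range]
      simp only [Prod.mk.injEq, eq_comm]
    rw [this]
    exact encard_range_fin fun i j h => hp (Prod.mk.inj h).1
  refine ⟨?_, ?_, ?_, ?_, hcp, hcard, hasMultidegree_zero_zero hcard, ?_⟩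
  · rw [← hspan]
    have := finrank_span_eq_card (linearIndependent_designSolution hD)
    rw [Matrix.range_cons, Matrix.range_cons, Matrix.range_empty, Set.union_empty,
      Set.singleton_union] at this
    simpa using this
  · intro F₁ F₂ hli hF
    obtain ⟨x, y, h₁⟩ := Submodule.mem_span_pair.1
      (hspan.trans hF.symm ▸ Submodule.subset_span (by simp) :
        F₁ ∈ Submodule.span K {designSolution u v 0, designSolution u v 1})
    obtain ⟨z, w, h₂⟩ := Submodule.mem_span_pair.1
      (hspan.trans hF.symm ▸ Submodule.subset_span (by simp) :
        F₂ ∈ Submodule.span K {designSolution u v 0, designSolution u v 1})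
    -- Otherwise `w F₁ - y F₂` and `z F₁ - x F₂` both vanish; independence then kills `x` and `y`,
    -- so `F₁ = 0`.
    have hdet : x * w - y * z ≠ 0 := by
      intro h0
      rw [LinearIndependent.pair_iff] at hli
      obtain ⟨hw, hy⟩ := hli w (-y) (by
        rw [← h₁, ← h₂]
        linear_combination (norm := module) h0 • designSolution u v 0)
      obtain ⟨hz, hx⟩ := hli z (-x) (by
        rw [← h₁, ← h₂]
        linear_combination (norm := module) -(h0 • designSolution u v 1))
      have hF0 : F₁ = 0 := by rw [← h₁, neg_eq_zero.1 hx, neg_eq_zero.1 hy]; simp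
      exact one_ne_zero (hli 1 0 (by simp [hF0])).1
    have hmap : ∀ s t : K,
        (s • designSolution u v 0 + t • designSolution u v 1).map (algebraMap K ℂ) =
        algebraMap K ℂ s • designSolution u' v' 0 + algebraMap K ℂ t • designSolution u' v' 1 := by
      intro s t
      rw [hu', hv', ← map_designSolution, ← map_designSolution]
      ext i j
      simp only [Matrix.map_apply, Matrix.add_apply, Matrix.smul_apply, smul_eq_mul, map_add,
        map_mul]
    have hdet' : algebraMap K ℂ x * algebraMap K ℂ w - algebraMap K ℂ y * algebraMap K ℂ z ≠ 0 := by
      rw [← map_mul, ← map_mul, ← map_sub]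
      exact (map_ne_zero _).2 hdet
    have hsplitF : IsSplitPencil (F₁.map (algebraMap K ℂ)) (F₂.map (algebraMap K ℂ)) := by
      rw [← h₁, ← h₂, hmap, hmap]
      exact hsplit.change_basis hdet'
    have hspanF : Submodule.span ℂ {F₁.map (algebraMap K ℂ), F₂.map (algebraMap K ℂ)} =
        matrixSpace (fun i => toComplex (X i)) fun i => toComplex (Y i) := by
      rw [← hspan', ← h₁, ← h₂, hmap, hmap]
      exact span_pair_change_basis hdet' _ _
    obtain ⟨p, q, hp, hq, ha, hb, hE⟩ := hsplitF.exists_points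
    rw [hspanF] at hE
    have hmem : ∀ a b, (a, b) ∈ complexCentersVariety X Y ↔ ∃ i, a = p i ∧ b = q i := hE
    have ha' : ∀ a, a ∈ complexIntersection (crossConics F₁ F₂) ↔ ∃ i, a = p i := fun a =>
      (mem_complexIntersection_crossConics_iff ..).trans (ha a)
    have hb' : ∀ b, b ∈ complexIntersection (crossConics F₁ᵀ F₂ᵀ) ↔ ∃ i, b = q i := fun b =>
      (mem_complexIntersection_crossConics_iff ..).trans (hb b)
    have hE' : ∀ a b, (a, b) ∈ complexCentersVariety X Y →
        a ∈ complexIntersection (crossConics F₁ F₂) ∧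
          b ∈ complexIntersection (crossConics F₁ᵀ F₂ᵀ) := by
      intro a b hab
      obtain ⟨i, hi, hi'⟩ := (hmem a b).1 hab
      exact ⟨(ha' a).2 ⟨i, hi⟩, (hb' b).2 ⟨i, hi'⟩⟩
    refine ⟨isConicTriple_crossConics hsplitF, isConicTriple_crossConics hsplitF.transpose,
      fun a b h => hE' _ _ (hcp a b h), ?_, ?_, hE', ?_, ?_⟩
    · rw [show complexIntersection (crossConics F₁ F₂) = Set.range p by
        ext a; simp only [ha', Set.mem_range, eq_comm]]
      exact encard_range_fin hp
    · rw [show complexIntersection (crossConics F₁ᵀ F₂ᵀ) = Set.range q by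
        ext b; simp only [hb', Set.mem_range, eq_comm]]
      exact encard_range_fin hq
    · intro a h
      obtain ⟨i, rfl⟩ := (ha' a).1 h
      refine ⟨q i, (hmem _ _).2 ⟨i, rfl, rfl⟩, fun b h' => ?_⟩
      obtain ⟨j, hj, rfl⟩ := (hmem _ _).1 h'
      rw [hp hj]
    · intro b h
      obtain ⟨i, rfl⟩ := (hb' b).1 h
      refine ⟨p i, (hmem _ _).2 ⟨i, rfl, rfl⟩, fun a h' => ?_⟩
      obtain ⟨j, rfl, hj⟩ := (hmem _ _).1 h'
      rw [hq hj]
  · intro a b b' h h'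
    obtain ⟨i, hi, hi'⟩ := (hmem _ _).1 (hcp a b h)
    obtain ⟨j, hj, hj'⟩ := (hmem _ _).1 (hcp a b' h')
    obtain rfl := hp (hi.symm.trans hj)
    exact toComplex_injective (hi'.trans hj'.symm)
  · intro a a' b h h'
    obtain ⟨i, hi, hi'⟩ := (hmem _ _).1 (hcp a b h)
    obtain ⟨j, hj, hj'⟩ := (hmem _ _).1 (hcp a' b h')
    obtain rfl := hq (hi'.symm.trans hj')
    exact toComplex_injective (hi.trans hj.symm)
  -- Center pairs over `K` inject into the three complex points of the variety.
  · rw [← hcard, ← (toComplex_injective.prodMap toComplex_injective).encard_image]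
    refine Set.encard_le_encard ?_
    rintro _ ⟨⟨a, b⟩, h, rfl⟩
    exact hcp a b h
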